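/- Let $p$ be a prime, let $\mathbb{C}_p$ be the $p$-adic completion of an algebraic closure of $\mathbb{Q}_p$, with $|p|_p=p^{-1}$, and fix an embedding $\overline{\mathbb{Q}}\hookrightarrow\mathbb{C}_p$. Let $0\neq f(t)\in\mathbb{Z}[t]$, let $p^\mu$ be the maximal power of $p$ dividing $f(t)$, and write $f(t)=a_0\prod_i(t-\alpha_i)$ in $\overline{\mathbb{Q}}[t]$, the product running over $i=1,\dots,\deg f$. Put $r_n=\mathrm{Res}(t^{p^n}-1,f(t))=\prod_{\zeta^{p^n}=1}f(\zeta)\in\mathbb{Z}$ for $n\ge 0$. Then $\bigl|p^{-\mu}a_0\prod_{|\alpha_j|_p>1}\alpha_j\bigr|_p=1$, and there are a unique root of unity $\xi\in\mathbb{C}_p$ of order prime to $p$ with $\bigl|p^{-\mu}a_0\prod_{|\alpha_j|_p>1}\alpha_j-\xi\bigr|_p<1$ and, for each $i$ with $|\alpha_i|_p=1$, a unique root of unity $\zeta_i\in\mathbb{C}_p$ of order prime to $p$ with $|\alpha_i-\zeta_i|_p<1$. Put $\varepsilon=(-1)^{p\deg f+\#\{i\,:\,|\alpha_i|_p<1\}}$,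 and for $|x|_p<1$ let $\log(1+x)=\sum_{n\ge1}\frac{-(-x)^n}{n}$ be the $p$-adic logarithm. (1) (i) If $p\mid f(t)$, then $\lim_{n\to\infty}r_n=0$ in $\mathbb{Z}_p$. (ii) If $p\nmid f(t)$, then $$\lim_{n\to\infty}r_n=\varepsilon\,\xi\prod_{i:\,|\alpha_i|_p=1}(\zeta_i-1)$$ in $\mathbb{Z}_p$, and the limit is zero if and only if $\zeta_i=1$ for some $i$ with $|\alpha_i|_p=1$. (2) For every $f\neq0$ (whether or not $p\mid f(t)$), consider the non-$p$-parts $r_n\,|r_n|_p\in\mathbb{Z}$ (which are $0$ if $r_n=0$). If $r_n\neq0$ for all $n\ge0$, then there is an integer $\nu$ with $p^{-\nu}=\prod_{i:\,|\alpha_i-1|_p<1}|\log\alpha_i|_p$, and $r_n\,|r_n|_p$ converges in $\mathbb{Z}_p$ to $$\varepsilon\,\xi\,\Bigl(\prod_{i:\,|\alpha_i|_p=1,\ |\alpha_i-1|_p=1}(\zeta_i-1)\Bigr)\,p^{-\nu}\prod_{i:\,|\alpha_i|_p=1,\ |\alpha_i-1|_p<1}\log\alpha_i .$$ If moreover every $\alpha_i$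 with $|\alpha_i-1|_p<1$ satisfies $|\alpha_i-1|_p<p^{-1/(p-1)}$, then $p^{\mu+\nu}=|f(1)|_p^{-1}$; in particular $p^{\nu}=|f(1)|_p^{-1}$ if $p\nmid f(t)$. If $r_n=0$ for some $n\ge0$, then $r_n\,|r_n|_p$ converges to $0$ and $\prod_{i:\,|\alpha_i|_p=1,\ |\alpha_i-1|_p<1}\log\alpha_i=0$. -/

import Mathlib

open Polynomial Filter Topology

/-- The `p`-power-th cyclic resultant `Res (t ^ (p ^ n) - 1, f)`. -/
noncomputable def cyclicResultant (p n : ℕ) (f : ℤ[X]) : ℤ :=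
  resultant (X ^ (p ^ n) - 1) f

/-- The non-`p`-part of an integer `r`, that is, the integer `r * |r|_p`
(see `cast_nonPPart`). -/
def nonPPart (p : ℕ) (r : ℤ) : ℤ :=
  r / (p : ℤ) ^ padicValInt p r

theorem cast_nonPPart (p : ℕ) [Fact p.Prime] (r : ℤ) :
    (nonPPart p r : ℚ) = r * padicNorm p r := by
  have hp : (p : ℚ) ≠ 0 := by exact_mod_cast (Fact.out : p.Prime).ne_zero
  by_cases hr : r = 0
  · simp [nonPPart, hr]
  · have hd : (p : ℤ) ^ padicValInt p r ∣ r := padicValInt_dvd r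
    rw [nonPPart, Int.cast_div hd (by push_cast; exact pow_ne_zero _ hp),
      padicNorm.eq_zpow_of_nonzero (by exact_mod_cast hr), padicValRat.of_int]
    push_cast
    rw [zpow_neg, zpow_natCast, div_eq_mul_inv]

/-- A `p`-prime-th root of unity: a root of unity of order prime to `p`. -/
def IsPPrimeRootOfUnity (p : ℕ) [Fact p.Prime] (ζ : ℂ_[p]) : Prop :=
  ∃ m : ℕ, 0 < m ∧ p.Coprime m ∧ ζ ^ m = 1

/-- `ζ` is a `p`-prime-th root of unity with `|α - ζ|_p < 1`. -/
def IsClosestRootOfUnity (p : ℕ) [Fact p.Prime] (α ζ : ℂ_[p]) : Prop :=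
  IsPPrimeRootOfUnity p ζ ∧ ‖α - ζ‖ < 1

/-- The `p`-adic logarithm `log (1 + x) = ∑_{n ≥ 1} -(-x) ^ n / n`; the series converges
for `|x|_p < 1`. -/
noncomputable def padicLog (p : ℕ) [Fact p.Prime] (α : ℂ_[p]) : ℂ_[p] :=
  ∑' n : ℕ, -(-(α - 1)) ^ (n + 1) / ((n : ℂ_[p]) + 1)

open Classical in
/-- The product `p ^ (-μ) * a₀ * ∏_{|α_i|_p > 1} α_i`. -/
noncomputable def normalizedLeadingTerm (p : ℕ) [Fact p.Prime] {d : ℕ} (μ : ℕ) (a₀ : ℂ_[p])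
    (α : Fin d → ℂ_[p]) : ℂ_[p] :=
  (p : ℂ_[p]) ^ (-(μ : ℤ)) * a₀ * ∏ i with 1 < ‖α i‖, α i

open Classical in
/-- The sign `(-1) ^ (p * d + #{i | |α_i|_p < 1})`, where `d` is the number of the `α_i`. -/
noncomputable def limitSign (p : ℕ) [Fact p.Prime] {d : ℕ} (α : Fin d → ℂ_[p]) : ℂ_[p] :=
  (-1) ^ (p * d + Finset.card {i | ‖α i‖ < 1})

/-!
Over `ℂ_[p]` the resultant is `r_n = a₀ ^ p ^ n * (-1) ^ (p ^ n * d) * ∏ (α_i ^ p ^ n - 1)`, and each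
factor has a simple asymptotic (`tendsto_pow_sub_one_div_mainPart`): it tends to `-1` if
`‖α_i‖ < 1`, is asymptotic to `α_i ^ p ^ n` if `1 < ‖α_i‖`, to `ζ_i ^ p ^ n - 1` if `‖α_i‖ = 1` and
`ζ_i ≠ 1`, and to `p ^ n * log α_i` if `‖α_i - 1‖ < 1` and the logarithm does not vanish. The last
one comes from the logarithm as the limit of `(α ^ p ^ n - 1) / p ^ n` (`tendsto_padicLog`), which
is dominated convergence in the binomial series. It also shows that `log α = 0` exactly when
`α ^ p ^ m = 1` for some `m`, that is, when some resultant vanishes.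

The sequences `ζ_i ^ p ^ n` do not converge individually, but `∏ (ζ_i ^ p ^ n - 1)` does not depend
on `n`, since the Frobenius permutes the `ζ_i`. No Galois theory of `ℚ_[p]` is needed for this:
with `f = p ^ μ * g`, Gauss's lemma shows that `N = p ^ (-μ) * a₀ * ∏_{1 < ‖α_i‖} α_i` is a unit,
and in the residue field of `ℂ_[p]` the polynomial `g` becomes `± N * ∏_{‖α_i‖ ≤ 1} (X - α_i)`
(`map_residueField_eq`). Its coefficients lie in the prime field, so the Frobenius fixes the residue
class of `N` and permutes those of the `α_i` (`map_reduction_pow_prime_pow`), and roots of unity of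
order prime to `p` are determined by their residue classes. Finiteness of the set of roots also
makes each residue class an element of a finite field, whence the existence of `ξ` and `ζ_i`.

Altogether, `r_n / p ^ (μ * p ^ n + n * k)` with `k = #{i | ‖α_i - 1‖ < 1}` converges to
`ε * ξ * ∏ (ζ_i - 1) * ∏ log α_i` (`tendsto_cyclicResultant_div`). All the limits follow from this
one: if the limit is nonzero, the valuation of `r_n` is `μ * p ^ n + n * k + ν` for large `n`.
-/

/-! ### Ultrametric preliminaries -/

section Ultrametric

variable {K : Type*} [NormedField K] [IsUltrametricDist K]

theorem norm_eq_of_norm_sub_lt {x y : K} (h : ‖x - y‖ < ‖y‖) : ‖x‖ = ‖y‖ := by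
  have := IsUltrametricDist.norm_add_eq_max_of_norm_ne_norm h.ne
  rwa [sub_add_cancel, max_eq_right h.le] at this

theorem norm_eq_one_of_norm_sub_lt {x y : K} (hy : ‖y‖ = 1) (h : ‖x - y‖ < 1) : ‖x‖ = 1 :=
  (norm_eq_of_norm_sub_lt (hy ▸ h)).trans hy

theorem norm_sub_lt_one_trans {x y z : K} (h₁ : ‖x - y‖ < 1) (h₂ : ‖y - z‖ < 1) :
    ‖x - z‖ < 1 := by
  rw [← sub_add_sub_cancel x y z]
  exact (IsUltrametricDist.norm_add_le_max _ _).trans_lt (max_lt h₁ h₂)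

theorem norm_mul_sub_mul_lt_one {x y x' y' : K} (hx : ‖x‖ ≤ 1) (hy' : ‖y'‖ ≤ 1)
    (h₁ : ‖x - x'‖ < 1) (h₂ : ‖y - y'‖ < 1) : ‖x * y - x' * y'‖ < 1 := by
  have : x * y - x' * y' = x * (y - y') + (x - x') * y' := by ring
  rw [this]
  refine (IsUltrametricDist.norm_add_le_max _ _).trans_lt (max_lt ?_ ?_) <;> rw [norm_mul]
  · exact (mul_le_of_le_one_left (norm_nonneg _) hx).trans_lt h₂
  · exact (mul_le_of_le_one_right (norm_nonneg _) hy').trans_lt h₁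

theorem norm_pow_sub_pow_lt_one {x y : K} (hx : ‖x‖ ≤ 1) (hy : ‖y‖ ≤ 1) (h : ‖x - y‖ < 1)
    (n : ℕ) : ‖x ^ n - y ^ n‖ < 1 := by
  induction n with
  | zero => simp
  | succ n ih =>
    rw [pow_succ, pow_succ]
    exact norm_mul_sub_mul_lt_one (by rw [norm_pow]; exact pow_le_one₀ (norm_nonneg _) hx) hy ih h

end Ultrametric

section

variable (p : ℕ) [hp : Fact p.Prime]

theorem norm_intCast_padicComplex (z : ℤ) : ‖(z : ℂ_[p])‖ = ‖(z : ℚ_[p])‖ := by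
  rw [← norm_algebraMap' ℂ_[p] (z : ℚ_[p]), map_intCast]

theorem norm_natCast_padicComplex (n : ℕ) : ‖(n : ℂ_[p])‖ = ‖(n : ℚ_[p])‖ := by
  exact_mod_cast norm_intCast_padicComplex p n

theorem norm_prime_padicComplex : ‖(p : ℂ_[p])‖ = (p : ℝ)⁻¹ := by
  rw [norm_natCast_padicComplex, Padic.norm_p]

theorem norm_prime_padicComplex_lt_one : ‖(p : ℂ_[p])‖ < 1 := by
  rw [norm_natCast_padicComplex]
  exact Padic.norm_p_lt_one

theorem prime_padicComplex_ne_zero : (p : ℂ_[p]) ≠ 0 := by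
  exact_mod_cast hp.out.ne_zero

theorem norm_inv_natCast_padicComplex_le (n : ℕ) : ‖((n : ℂ_[p]))⁻¹‖ ≤ n := by
  rcases Nat.eq_zero_or_pos n with rfl | hn
  · simp
  rw [norm_inv, norm_natCast_padicComplex, Padic.norm_eq_zpow_neg_valuation (by exact_mod_cast hn.ne'),
    Padic.valuation_natCast, zpow_neg, inv_inv, zpow_natCast]
  exact_mod_cast Nat.le_of_dvd hn pow_padicValNat_dvd

/-! ### The logarithm as a limit of difference quotients -/

theorem tendsto_prime_pow_padicComplex : Tendsto (fun n => (p : ℂ_[p]) ^ n) atTop (𝓝 0) :=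
  tendsto_pow_atTop_nhds_zero_of_norm_lt_one (norm_prime_padicComplex_lt_one p)

/-- Pascal's rule and `C(p ^ n, j + 1) → 0` give `C(p ^ n - 1, j) → (-1) ^ j`, the binomial
coefficient `C(-1, j)`. -/
theorem tendsto_choose_prime_pow_sub_one (j : ℕ) :
    Tendsto (fun n => ((p ^ n - 1).choose j : ℂ_[p])) atTop (𝓝 ((-1) ^ j)) := by
  induction j with
  | zero => simp
  | succ j ih =>
    have h0 : Tendsto (fun n => ((p ^ n).choose (j + 1) : ℂ_[p])) atTop (𝓝 0) := by
      have h1 : ∀ n, ((p ^ n).choose (j + 1) : ℂ_[p]) =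
          (p : ℂ_[p]) ^ n * ((p ^ n - 1).choose j : ℂ_[p]) * ((j + 1 : ℕ) : ℂ_[p])⁻¹ := by
        intro n
        have h2 := Nat.add_one_mul_choose_eq (p ^ n - 1) j
        rw [Nat.sub_add_cancel (pow_pos hp.out.pos _)] at h2
        rw [eq_mul_inv_iff_mul_eq₀ (by exact_mod_cast j.succ_ne_zero)]
        exact_mod_cast h2.symm
      simp_rw [h1]
      simpa using ((tendsto_prime_pow_padicComplex p).mul ih).mul_const ((j + 1 : ℕ) : ℂ_[p])⁻¹
    have h := h0.sub ih
    rw [zero_sub, ← neg_one_mul, ← pow_succ'] at h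
    refine h.congr fun n => ?_
    have h2 := Nat.choose_succ_succ (p ^ n - 1) j
    rw [Nat.succ_eq_add_one, Nat.sub_add_cancel (pow_pos hp.out.pos _)] at h2
    rw [h2]
    push_cast
    ring

theorem prime_pow_difference_quotient_eq_tsum (a : ℂ_[p]) (n : ℕ) :
    (a ^ p ^ n - 1) / (p : ℂ_[p]) ^ n =
      ∑' j : ℕ, ((p ^ n - 1).choose j : ℂ_[p]) * (a - 1) ^ (j + 1) * ((j + 1 : ℕ) : ℂ_[p])⁻¹ := by
  have hq : p ^ n ≠ 0 := (pow_pos hp.out.pos _).ne'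
  have hpn : (p : ℂ_[p]) ^ n ≠ 0 := pow_ne_zero _ (prime_padicComplex_ne_zero p)
  obtain ⟨q, hq⟩ := Nat.exists_eq_succ_of_ne_zero hq
  rw [tsum_eq_sum (s := Finset.range (p ^ n)), div_eq_iff hpn, Finset.sum_mul]
  · conv_lhs => rw [← sub_add_cancel a 1, add_pow, Finset.sum_range_succ']
    simp only [one_pow, mul_one, pow_zero, Nat.choose_zero_right, Nat.cast_one, add_sub_cancel_right]
    refine Finset.sum_congr rfl fun j _ => ?_
    have h2 := Nat.add_one_mul_choose_eq (p ^ n - 1) j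
    rw [Nat.sub_add_cancel (by omega)] at h2
    have h3 : (p : ℂ_[p]) ^ n * ((p ^ n - 1).choose j : ℂ_[p]) =
      ((p ^ n).choose (j + 1) : ℂ_[p]) * ((j + 1 : ℕ) : ℂ_[p]) := by exact_mod_cast h2
    have h4 : ((j + 1 : ℕ) : ℂ_[p]) ≠ 0 := by exact_mod_cast j.succ_ne_zero
    field_simp
    linear_combination -(a - 1) ^ (j + 1) * h3
  · intro j hj
    rw [Nat.choose_eq_zero_of_lt (by rw [Finset.mem_range] at hj; omega)]
    simp

/-- Dominated convergence, with the terms bounded by `(j + 1) * ‖a - 1‖ ^ (j + 1)`. -/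
theorem tendsto_padicLog {a : ℂ_[p]} (ha : ‖a - 1‖ < 1) :
    Tendsto (fun n => (a ^ p ^ n - 1) / (p : ℂ_[p]) ^ n) atTop (𝓝 (padicLog p a)) := by
  simp_rw [prime_pow_difference_quotient_eq_tsum]
  refine tendsto_tsum_of_dominated_convergence
    (bound := fun j => ((j + 1 : ℕ) : ℝ) ^ 1 * ‖a - 1‖ ^ (j + 1)) ?_ ?_ ?_
  · exact (summable_nat_add_iff 1).2
      (summable_pow_mul_geometric_of_norm_lt_one 1 (r := ‖a - 1‖) (by simpa using ha))
  · intro j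
    have h := ((tendsto_choose_prime_pow_sub_one p j).mul_const
      ((a - 1) ^ (j + 1))).mul_const ((j + 1 : ℕ) : ℂ_[p])⁻¹
    convert h using 2
    rw [neg_pow (a - 1), div_eq_mul_inv]
    push_cast
    ring
  · refine Eventually.of_forall fun n j => ?_
    rw [norm_mul, norm_mul, norm_pow, pow_one, mul_comm]
    refine mul_le_mul (norm_inv_natCast_padicComplex_le p _) ?_ (by positivity) (by positivity)
    exact mul_le_of_le_one_left (by positivity) (IsUltrametricDist.norm_natCast_le_one _ _)

theorem tendsto_pow_prime_pow_one {a : ℂ_[p]} (ha : ‖a - 1‖ < 1) :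
    Tendsto (fun n => a ^ p ^ n) atTop (𝓝 1) := by
  have h := ((tendsto_padicLog p ha).mul (tendsto_prime_pow_padicComplex p)).add_const 1
  rw [mul_zero, zero_add] at h
  refine h.congr fun n => ?_
  have hpn : (p : ℂ_[p]) ^ n ≠ 0 := pow_ne_zero _ (prime_padicComplex_ne_zero p)
  field_simp
  ring

/-- In `(1 + x) ^ p - 1` the linear term `p * x` dominates strictly. -/
theorem norm_pow_prime_sub_one {a : ℂ_[p]} (ha : ‖a - 1‖ ^ (p - 1) < (p : ℝ)⁻¹) :
    ‖a ^ p - 1‖ = (p : ℝ)⁻¹ * ‖a - 1‖ := by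
  have hp2 := hp.out.two_le
  rcases eq_or_ne a 1 with rfl | ha1
  · simp
  set x := a - 1 with hx
  have hx0 : 0 < ‖x‖ := norm_pos_iff.2 (sub_ne_zero.2 ha1)
  have hp0 : 0 < (p : ℝ)⁻¹ := by have := hp.out.pos; positivity
  have hx1 : ‖x‖ < 1 := by
    by_contra! h
    have h1 : (p : ℝ)⁻¹ ≤ 1 := inv_le_one_of_one_le₀ (by exact_mod_cast hp.out.one_le)
    exact absurd (one_le_pow₀ h (n := p - 1)) (by linarith)
  rw [← norm_prime_padicComplex p, ← norm_mul]
  refine norm_eq_of_norm_sub_lt ?_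
  have hexp : a ^ p - 1 - p * x =
      ∑ k ∈ Finset.range (p - 1), x ^ (k + 2) * (p.choose (k + 2) : ℂ_[p]) := by
    have hax : a = x + 1 := by rw [hx]; ring
    conv_lhs => rw [hax, add_pow, show p + 1 = (p - 1) + 1 + 1 by omega, Finset.sum_range_succ',
      Finset.sum_range_succ']
    simp
    ring
  rw [hexp]
  obtain ⟨k, hk, hle⟩ := IsUltrametricDist.exists_norm_finsetSum_le_of_nonempty
    (t := Finset.range (p - 1)) ⟨0, by simp; omega⟩
    (fun k => x ^ (k + 2) * (p.choose (k + 2) : ℂ_[p]))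
  refine hle.trans_lt ?_
  rw [Finset.mem_range] at hk
  rw [norm_mul, norm_mul, norm_pow]
  rcases eq_or_ne (k + 2) p with hkp | hkp
  · rw [hkp, Nat.choose_self, Nat.cast_one, norm_one, mul_one, norm_prime_padicComplex,
      ← pow_sub_one_mul hp.out.ne_zero]
    exact mul_lt_mul_of_pos_right ha hx0
  · obtain ⟨c, hc⟩ := hp.out.dvd_choose_self (k := k + 2) (by omega) (by omega)
    rw [hc, Nat.cast_mul, norm_mul, mul_left_comm]
    refine mul_lt_mul_of_pos_left ?_ (by rw [norm_prime_padicComplex]; exact hp0)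
    calc ‖x‖ ^ (k + 2) * ‖(c : ℂ_[p])‖ ≤ ‖x‖ ^ (k + 2) :=
          mul_le_of_le_one_right (by positivity) (IsUltrametricDist.norm_natCast_le_one _ _)
      _ < ‖x‖ := pow_lt_self_of_lt_one₀ hx0 hx1 (by omega)

theorem norm_pow_prime_pow_sub_one {a : ℂ_[p]} (ha : ‖a - 1‖ ^ (p - 1) < (p : ℝ)⁻¹) (n : ℕ) :
    ‖a ^ p ^ n - 1‖ = ‖(p : ℂ_[p]) ^ n‖ * ‖a - 1‖ := by
  induction n with
  | zero => simp
  | succ n ih =>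
    have hle : ‖a ^ p ^ n - 1‖ ≤ ‖a - 1‖ := by
      rw [ih, norm_pow]
      exact mul_le_of_le_one_left (norm_nonneg _)
        (pow_le_one₀ (norm_nonneg _) (norm_prime_padicComplex_lt_one p).le)
    rw [pow_succ, pow_mul, norm_pow_prime_sub_one p
      ((pow_le_pow_left₀ (norm_nonneg _) hle _).trans_lt ha), ih, pow_succ, norm_mul,
      norm_prime_padicComplex]
    ring

theorem norm_padicLog_eq {a : ℂ_[p]} (ha : ‖a - 1‖ < 1) (ha' : ‖a - 1‖ ^ (p - 1) < (p : ℝ)⁻¹) :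
    ‖padicLog p a‖ = ‖a - 1‖ := by
  refine tendsto_nhds_unique (tendsto_padicLog p ha).norm (tendsto_const_nhds.congr fun n => ?_)
  have hpn : ‖(p : ℂ_[p]) ^ n‖ ≠ 0 :=
    norm_ne_zero_iff.2 (pow_ne_zero _ (prime_padicComplex_ne_zero p))
  rw [norm_div, norm_pow_prime_pow_sub_one p ha']
  field_simp

theorem padicLog_eq_zero_of_pow_eq_one {a : ℂ_[p]} (ha : ‖a - 1‖ < 1) {m : ℕ}
    (h : a ^ p ^ m = 1) : padicLog p a = 0 := by
  refine tendsto_nhds_unique (tendsto_padicLog p ha) (tendsto_const_nhds.congr' ?_)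
  filter_upwards [eventually_ge_atTop m] with n hn
  obtain ⟨k, rfl⟩ := Nat.exists_eq_add_of_le hn
  simp [pow_add, pow_mul, h]

/-- Some power `a ^ p ^ m` is so close to `1` that the logarithm preserves its distance from `1`. -/
theorem exists_pow_eq_one_of_padicLog_eq_zero {a : ℂ_[p]} (ha : ‖a - 1‖ < 1)
    (h : padicLog p a = 0) : ∃ m : ℕ, a ^ p ^ m = 1 := by
  have hp0 : 0 < (p : ℝ)⁻¹ := by have := hp.out.pos; positivity
  have hp1 : p - 1 ≠ 0 := by have := hp.out.two_le; omega
  have h1 : Tendsto (fun n => ‖a ^ p ^ n - 1‖ ^ (p - 1)) atTop (𝓝 0) := by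
    simpa [hp1] using (((tendsto_pow_prime_pow_one p ha).sub_const 1).norm).pow (p - 1)
  obtain ⟨m, hm⟩ := (h1.eventually_lt_const hp0).exists
  refine ⟨m, ?_⟩
  have hpm : (p : ℂ_[p]) ^ m ≠ 0 := pow_ne_zero _ (prime_padicComplex_ne_zero p)
  have h2 := ((tendsto_padicLog p ha).comp (tendsto_add_atTop_nat m)).norm
  have h3 : ‖padicLog p a‖ = ‖a ^ p ^ m - 1‖ / ‖(p : ℂ_[p]) ^ m‖ := by
    refine tendsto_nhds_unique h2 (tendsto_const_nhds.congr fun n => ?_)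
    have hpn : ‖(p : ℂ_[p]) ^ n‖ ≠ 0 :=
      norm_ne_zero_iff.2 (pow_ne_zero _ (prime_padicComplex_ne_zero p))
    simp only [Function.comp_apply]
    rw [norm_div, add_comm n m, pow_add, pow_mul, norm_pow_prime_pow_sub_one p hm, pow_add,
      norm_mul, mul_comm, mul_div_mul_right _ _ hpn]
  rw [h, norm_zero, eq_comm, div_eq_zero_iff, norm_eq_zero, norm_eq_zero, sub_eq_zero] at h3
  exact h3.resolve_right hpm

/-! ### Roots of unity of order prime to `p` -/

variable {p}

theorem IsPPrimeRootOfUnity.norm_eq_one {ζ : ℂ_[p]} (h : IsPPrimeRootOfUnity p ζ) : ‖ζ‖ = 1 := by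
  obtain ⟨m, hm, -, hζ⟩ := h
  have h := congrArg norm hζ
  rw [norm_pow, norm_one] at h
  exact (pow_eq_one_iff_of_nonneg (norm_nonneg _) hm.ne').1 h

theorem IsPPrimeRootOfUnity.ne_zero {ζ : ℂ_[p]} (h : IsPPrimeRootOfUnity p ζ) : ζ ≠ 0 :=
  norm_ne_zero_iff.1 (by rw [h.norm_eq_one]; exact one_ne_zero)

theorem IsPPrimeRootOfUnity.pow {ζ : ℂ_[p]} (h : IsPPrimeRootOfUnity p ζ) (n : ℕ) :
    IsPPrimeRootOfUnity p (ζ ^ n) := by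
  obtain ⟨m, hm, hc, hζ⟩ := h
  exact ⟨m, hm, hc, by rw [← pow_mul, mul_comm, pow_mul, hζ, one_pow]⟩

theorem isPPrimeRootOfUnity_one : IsPPrimeRootOfUnity p 1 := ⟨1, by simp⟩

/-- If `u ^ m = 1` and `u ≡ 1`, then `(u ^ m - 1) / (u - 1) = 1 + u + ⋯ + u ^ (m - 1) ≡ m` is a
unit for `m` prime to `p`. -/
theorem eq_one_of_pow_eq_one_of_norm_sub_one_lt {u : ℂ_[p]} {m : ℕ} (hm : p.Coprime m)
    (hu : u ^ m = 1) (h : ‖u - 1‖ < 1) : u = 1 := by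
  have h1 := norm_eq_one_of_norm_sub_lt (norm_one) h
  have hsum : ‖(∑ i ∈ Finset.range m, u ^ i) - (m : ℂ_[p])‖ < 1 := by
    have : (∑ i ∈ Finset.range m, u ^ i) - (m : ℂ_[p]) =
        ∑ i ∈ Finset.range m, (u ^ i - 1) := by simp
    rw [this]
    obtain ⟨i, -, hi⟩ := IsUltrametricDist.exists_norm_finsetSum_le
      (Finset.range m) (fun i => u ^ i - 1)
    refine hi.trans_lt ?_
    simpa using norm_pow_sub_pow_lt_one h1.le norm_one.le h i
  have hm1 : ‖(m : ℂ_[p])‖ = 1 := by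
    rw [norm_natCast_padicComplex, Padic.norm_natCast_eq_one_iff]
    exact hm
  have hne : (∑ i ∈ Finset.range m, u ^ i) ≠ 0 := by
    rw [← norm_ne_zero_iff, norm_eq_one_of_norm_sub_lt hm1 hsum]
    exact one_ne_zero
  have := geom_sum_mul u m
  rw [hu, sub_self, mul_eq_zero] at this
  exact sub_eq_zero.1 (this.resolve_left hne)

theorem IsPPrimeRootOfUnity.eq_of_norm_sub_lt_one {ζ ζ' : ℂ_[p]} (h : IsPPrimeRootOfUnity p ζ)
    (h' : IsPPrimeRootOfUnity p ζ') (hlt : ‖ζ - ζ'‖ < 1) : ζ = ζ' := by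
  obtain ⟨m, hm, hc, hζ⟩ := id h
  obtain ⟨m', hm', hc', hζ'⟩ := id h'
  have h0 := h'.ne_zero
  rw [← div_eq_one_iff_eq h0]
  refine eq_one_of_pow_eq_one_of_norm_sub_one_lt (m := m * m') (hc.mul_right hc') ?_ ?_
  · rw [div_pow, pow_mul, hζ, mul_comm, pow_mul, hζ']
    simp
  · rwa [div_sub_one h0, norm_div, h'.norm_eq_one, div_one]

/-- The product of the distances of `a` to the `m`-th roots of unity is `‖a ^ m - 1‖`. -/
theorem exists_isClosestRootOfUnity {a : ℂ_[p]} {m : ℕ} (hm : 0 < m) (hc : p.Coprime m)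
    (h : ‖a ^ m - 1‖ < 1) : ∃ ζ, IsClosestRootOfUnity p a ζ := by
  have hmonic : (X ^ m - 1 : ℂ_[p][X]).Monic := monic_X_pow_sub_C 1 hm.ne'
  have hsplit := IsAlgClosed.splits (X ^ m - 1 : ℂ_[p][X])
  have heval : a ^ m - 1 = ((X ^ m - 1 : ℂ_[p][X]).roots.map fun ζ => a - ζ).prod := by
    have := hsplit.eval_eq_prod_roots a
    rw [hmonic.leadingCoeff, one_mul] at this
    simpa using this
  by_contra! hcon
  have hge : 1 ≤ ‖a ^ m - 1‖ := by
    rw [heval, ← normHom_apply, map_multiset_prod, Multiset.map_map]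
    refine Multiset.one_le_prod fun x hx => ?_
    obtain ⟨ζ, hζ, rfl⟩ := Multiset.mem_map.1 hx
    have hroot : ζ ^ m = 1 := by
      have := isRoot_of_mem_roots hζ
      simpa [sub_eq_zero] using this
    by_contra! hlt
    exact hcon ζ ⟨⟨m, hm, hc, hroot⟩, hlt⟩
  linarith

theorem IsClosestRootOfUnity.eq {a ζ ζ' : ℂ_[p]} (h : IsClosestRootOfUnity p a ζ)
    (h' : IsClosestRootOfUnity p a ζ') : ζ = ζ' :=
  h.1.eq_of_norm_sub_lt_one h'.1
    (norm_sub_lt_one_trans (by rw [norm_sub_rev]; exact h.2) h'.2)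

theorem existsUnique_isClosestRootOfUnity {a : ℂ_[p]} {m : ℕ} (hm : 0 < m) (hc : p.Coprime m)
    (h : ‖a ^ m - 1‖ < 1) : ∃! ζ, IsClosestRootOfUnity p a ζ := by
  obtain ⟨ζ, hζ⟩ := exists_isClosestRootOfUnity hm hc h
  exact ⟨ζ, hζ, fun ζ' hζ' => hζ'.eq hζ⟩

theorem IsClosestRootOfUnity.norm_eq_one {a ζ : ℂ_[p]} (h : IsClosestRootOfUnity p a ζ) :
    ‖a‖ = 1 :=
  norm_eq_one_of_norm_sub_lt h.1.norm_eq_one h.2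

theorem IsClosestRootOfUnity.eq_one_iff {a ζ : ℂ_[p]} (h : IsClosestRootOfUnity p a ζ) :
    ζ = 1 ↔ ‖a - 1‖ < 1 :=
  ⟨fun h1 => h1 ▸ h.2, fun h1 => h.eq ⟨isPPrimeRootOfUnity_one, h1⟩⟩

theorem IsClosestRootOfUnity.tendsto_div {a ζ : ℂ_[p]} (h : IsClosestRootOfUnity p a ζ) :
    Tendsto (fun n => a ^ p ^ n / ζ ^ p ^ n) atTop (𝓝 1) := by
  simp_rw [← div_pow]
  refine tendsto_pow_prime_pow_one p ?_
  rw [div_sub_one h.1.ne_zero, norm_div, h.1.norm_eq_one, div_one]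
  exact h.2

theorem IsPPrimeRootOfUnity.norm_sub_one {ζ : ℂ_[p]} (h : IsPPrimeRootOfUnity p ζ)
    (h1 : ζ ≠ 1) : ‖ζ - 1‖ = 1 := by
  refine le_antisymm ?_ ?_
  · rw [sub_eq_add_neg]
    refine (IsUltrametricDist.norm_add_le_max _ _).trans ?_
    simp [h.norm_eq_one]
  · by_contra! hlt
    exact h1 (h.eq_of_norm_sub_lt_one isPPrimeRootOfUnity_one hlt)

theorem IsPPrimeRootOfUnity.pow_prime_pow_ne_one {ζ : ℂ_[p]} (h : IsPPrimeRootOfUnity p ζ)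
    (h1 : ζ ≠ 1) (n : ℕ) : ζ ^ p ^ n ≠ 1 := by
  obtain ⟨m, hm, hc, hζ⟩ := h
  intro hpn
  refine h1 (orderOf_eq_one_iff.1 (Nat.eq_one_of_dvd_coprimes (hc.pow_left n)
    (orderOf_dvd_of_pow_eq_one hpn) (orderOf_dvd_of_pow_eq_one hζ)))

/-- `‖ζ ^ p ^ n - 1‖ = 1` for all `n`, so the error `a ^ p ^ n - ζ ^ p ^ n → 0` is relatively
small. -/
theorem IsClosestRootOfUnity.tendsto_sub_one_div {a ζ : ℂ_[p]} (h : IsClosestRootOfUnity p a ζ)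
    (h1 : ζ ≠ 1) :
    Tendsto (fun n => (a ^ p ^ n - 1) / (ζ ^ p ^ n - 1)) atTop (𝓝 1) := by
  rw [tendsto_iff_norm_sub_tendsto_zero]
  have h2 := tendsto_iff_norm_sub_tendsto_zero.1 h.tendsto_div
  refine h2.congr fun n => ?_
  have hne := h.1.pow_prime_pow_ne_one h1 n
  rw [div_sub_one (sub_ne_zero.2 hne), div_sub_one (pow_ne_zero _ h.1.ne_zero), norm_div, norm_div,
    (h.1.pow _).norm_sub_one hne, norm_pow, h.1.norm_eq_one]
  simp

end

/-! ### Reduction modulo the maximal ideal -/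

section Reduction

open IsLocalRing

variable {K : Type*} [NormedField K] [IsUltrametricDist K]

variable (K) in
/-- The closed unit ball of an ultrametric field, as a valuation ring. -/
noncomputable abbrev unitBall : ValuationSubring K := (NormedField.valuation (K := K)).valuationSubring

theorem mem_unitBall_iff {x : K} : x ∈ unitBall K ↔ ‖x‖ ≤ 1 := Iff.rfl

theorem isUnit_unitBall_iff {x : unitBall K} : IsUnit x ↔ ‖(x : K)‖ = 1 := by
  have h := Valuation.Integers.isUnit_iff_valuation_eq_one
    (Valuation.integer.integers (NormedField.valuation (K := K))) (x := x)
  refine h.trans ?_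
  rw [← NNReal.coe_inj]
  rfl

theorem residue_unitBall_eq_zero_iff {x : unitBall K} :
    residue (unitBall K) x = 0 ↔ ‖(x : K)‖ < 1 := by
  rw [residue_eq_zero_iff, mem_maximalIdeal, mem_nonunits_iff, isUnit_unitBall_iff]
  exact ⟨fun h => lt_of_le_of_ne (mem_unitBall_iff.1 x.2) h, fun h => h.ne⟩

open Classical in
/-- The element of the unit ball given by `x`, with the junk value `0` for `1 < ‖x‖`. -/
noncomputable def toUnitBall (x : K) : unitBall K := if h : ‖x‖ ≤ 1 then ⟨x, h⟩ else 0

theorem coe_toUnitBall {x : K} (h : ‖x‖ ≤ 1) : (toUnitBall x : K) = x := by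
  rw [toUnitBall, dif_pos h]

/-- The residue class of `x`, with the junk value `0` for `1 < ‖x‖`. -/
noncomputable def reduction (x : K) : ResidueField (unitBall K) := residue _ (toUnitBall x)

theorem reduction_eq_iff {x y : K} (hx : ‖x‖ ≤ 1) (hy : ‖y‖ ≤ 1) :
    reduction x = reduction y ↔ ‖x - y‖ < 1 := by
  rw [reduction, reduction, ← sub_eq_zero, ← map_sub, residue_unitBall_eq_zero_iff]
  simp [coe_toUnitBall hx, coe_toUnitBall hy]

theorem reduction_eq_zero_iff {x : K} (hx : ‖x‖ ≤ 1) : reduction x = 0 ↔ ‖x‖ < 1 := by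
  rw [reduction, residue_unitBall_eq_zero_iff, coe_toUnitBall hx]

theorem reduction_one : reduction (1 : K) = 1 := by
  rw [reduction, ← map_one (residue (unitBall K))]
  congr 1
  exact Subtype.ext (coe_toUnitBall norm_one.le)

theorem reduction_pow {x : K} (hx : ‖x‖ ≤ 1) (n : ℕ) :
    reduction (x ^ n) = reduction x ^ n := by
  rw [reduction, reduction, ← map_pow]
  congr 1
  refine Subtype.ext ?_
  rw [coe_toUnitBall (by rw [norm_pow]; exact pow_le_one₀ (norm_nonneg _) hx)]
  simp [coe_toUnitBall hx]

end Reduction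

section

open IsLocalRing

variable {p : ℕ} [hp : Fact p.Prime]

instance charP_residueField_unitBall : CharP (ResidueField (unitBall ℂ_[p])) p := by
  refine (CharP.charP_iff_prime_eq_zero hp.out).2 ?_
  rw [← map_natCast (residue (unitBall ℂ_[p])), residue_unitBall_eq_zero_iff]
  simpa using norm_prime_padicComplex_lt_one p

/-- A unit whose residue class lies in a finite field has a closest root of unity. -/
theorem existsUnique_isClosestRootOfUnity_of_reduction_pow_eq {x : ℂ_[p]} (hx : ‖x‖ = 1) {e : ℕ}
    (he : e ≠ 0) (h : reduction x ^ p ^ e = reduction x) :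
    ∃! ζ, IsClosestRootOfUnity p x ζ := by
  have h1 : 1 < p ^ e := Nat.one_lt_pow he hp.out.one_lt
  have hx0 : reduction x ≠ 0 := by
    rw [Ne, reduction_eq_zero_iff hx.le, hx]
    exact lt_irrefl _
  refine existsUnique_isClosestRootOfUnity (m := p ^ e - 1) (by omega) ?_ ?_
  · have hcop : (p ^ e).Coprime (p ^ e - 1) :=
      (Nat.coprime_self_sub_right h1.le).2 (Nat.coprime_one_right _)
    exact hcop.coprime_dvd_left (dvd_pow_self p he)
  · rw [← reduction_eq_iff (by simp [hx]) norm_one.le, reduction_pow hx.le, reduction_one]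
    refine mul_right_cancel₀ hx0 ?_
    rw [← pow_succ, Nat.sub_add_cancel h1.le, h, one_mul]

/-! ### Factorization modulo `p` -/

variable {ι : Type*} [Fintype ι]

open Classical in
/-- For `c * ∏ (X - α i)`, the cofactor of `c * ∏_{1 < ‖α i‖} α i`, which has coefficients in the
unit ball: the factors `X - α i` with `1 < ‖α i‖` are replaced by `(α i)⁻¹ * X - 1`. -/
noncomputable def integralFactor (α : ι → ℂ_[p]) : (unitBall ℂ_[p])[X] :=
  (∏ i with ‖α i‖ ≤ 1, (X - C (toUnitBall (α i)))) *
    ∏ i with ¬ ‖α i‖ ≤ 1, (C (toUnitBall (α i)⁻¹) * X - 1)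

open Classical in
theorem C_mul_map_integralFactor (α : ι → ℂ_[p]) (c : ℂ_[p]) :
    C (c * ∏ i with 1 < ‖α i‖, α i) * (integralFactor α).map (unitBall ℂ_[p]).subtype =
      C c * ∏ i, (X - C (α i)) := by
  have h1 : ∀ i ∈ Finset.univ.filter (fun i => ‖α i‖ ≤ 1),
      X - C ((unitBall ℂ_[p]).subtype (toUnitBall (α i))) = X - C (α i) := by
    intro i hi
    rw [Finset.mem_filter] at hi
    rw [ValuationSubring.subtype_apply, coe_toUnitBall hi.2]
  have h2 : ∀ i ∈ Finset.univ.filter (fun i => ¬ ‖α i‖ ≤ 1),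
      C (α i) * (C ((unitBall ℂ_[p]).subtype (toUnitBall (α i)⁻¹)) * X - 1) = X - C (α i) := by
    intro i hi
    rw [Finset.mem_filter, not_le] at hi
    have h0 : α i ≠ 0 := norm_ne_zero_iff.1 (by linarith [hi.2])
    rw [ValuationSubring.subtype_apply, coe_toUnitBall, mul_sub, ← mul_assoc, ← C_mul,
      mul_inv_cancel₀ h0, C_1, one_mul, mul_one]
    rw [norm_inv]
    exact inv_le_one_of_one_le₀ hi.2.le
  rw [integralFactor, Polynomial.map_mul, Polynomial.map_prod, Polynomial.map_prod, C_mul,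
    ← Finset.prod_filter_mul_prod_filter_not Finset.univ (fun i => ‖α i‖ ≤ 1)
      (fun i => X - C (α i)), ← Finset.prod_congr rfl h1, ← Finset.prod_congr rfl h2,
    Finset.prod_mul_distrib, map_prod]
  simp only [Polynomial.map_sub, map_X, map_C, Polynomial.map_mul, Polynomial.map_one, not_le]
  ring

open Classical in
theorem map_residue_integralFactor (α : ι → ℂ_[p]) :
    (integralFactor α).map (residue _) =
      C ((-1) ^ (Finset.univ.filter fun i => ¬ ‖α i‖ ≤ 1).card) *
        ∏ i with ‖α i‖ ≤ 1, (X - C (reduction (α i))) := by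
  have h2 : ∀ i ∈ Finset.univ.filter (fun i => ¬ ‖α i‖ ≤ 1),
      (C (residue (unitBall ℂ_[p]) (toUnitBall (α i)⁻¹)) * X - 1) = C (-1) := by
    intro i hi
    rw [Finset.mem_filter, not_le] at hi
    have hlt : ‖(α i)⁻¹‖ < 1 := by
      rw [norm_inv]
      exact inv_lt_one_of_one_lt₀ hi.2
    have h0 : residue (unitBall ℂ_[p]) (toUnitBall (α i)⁻¹) = 0 :=
      (reduction_eq_zero_iff hlt.le).2 hlt
    simp [h0]
  rw [integralFactor, Polynomial.map_mul, Polynomial.map_prod, Polynomial.map_prod]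
  simp only [Polynomial.map_sub, map_X, map_C, Polynomial.map_mul, Polynomial.map_one]
  rw [Finset.prod_congr rfl h2, Finset.prod_const, ← C_pow, mul_comm]
  rfl

theorem exists_norm_coeff_eq_one {g : ℤ[X]} (hg : ¬ C (p : ℤ) ∣ g) :
    ∃ m, ‖((g.coeff m : ℤ) : ℂ_[p])‖ = 1 := by
  by_contra! h
  refine hg (C_dvd_iff_dvd_coeff _ _ |>.2 fun m => ?_)
  rw [← Padic.norm_intCast_lt_one_iff, ← norm_intCast_padicComplex]
  exact lt_of_le_of_ne (by
    rw [norm_intCast_padicComplex]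
    exact Padic.norm_int_le_one _) (h m)

section Primitive

variable {g : ℤ[X]} (hg : ¬ C (p : ℤ) ∣ g) {c : ℂ_[p]} {α : ι → ℂ_[p]}
  (hfac : g.map (Int.castRingHom ℂ_[p]) = C c * ∏ i, (X - C (α i)))

include hg hfac

open Classical in
/-- Gauss's lemma: both `g` and `integralFactor α` have content `1`. -/
theorem norm_leading_mul_prod_eq_one : ‖c * ∏ i with 1 < ‖α i‖, α i‖ = 1 := by
  set N := c * ∏ i with 1 < ‖α i‖, α i with hN
  have hcoeff : ∀ m, ((g.coeff m : ℤ) : ℂ_[p]) = N * ((integralFactor α).coeff m : ℂ_[p]) := by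
    intro m
    have h := congrArg (fun q => q.coeff m) (hfac.trans (C_mul_map_integralFactor α c).symm)
    simpa only [coeff_map, coeff_C_mul, eq_intCast, ValuationSubring.subtype_apply] using h
  refine le_antisymm ?_ ?_
  · have hmonic : (∏ i with ‖α i‖ ≤ 1, (X - C (reduction (α i)))).Monic :=
      monic_prod_of_monic _ _ fun i _ => monic_X_sub_C _
    obtain ⟨k, hk⟩ : ∃ k, (∏ i with ‖α i‖ ≤ 1, (X - C (reduction (α i)))).coeff k = 1 :=
      ⟨_, hmonic.coeff_natDegree⟩
    have h1 := congrArg (fun q => q.coeff k) (map_residue_integralFactor α)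
    simp only [coeff_map, coeff_C_mul] at h1
    rw [hk, mul_one] at h1
    have h2 : ‖((integralFactor α).coeff k : ℂ_[p])‖ = 1 := by
      refine le_antisymm (mem_unitBall_iff.1 ((integralFactor α).coeff k).2) (not_lt.1 fun h => ?_)
      rw [← residue_unitBall_eq_zero_iff, h1] at h
      exact pow_ne_zero _ (neg_ne_zero.2 one_ne_zero) h
    have h3 := congrArg norm (hcoeff k)
    rw [norm_mul, h2, mul_one] at h3
    rw [← h3, norm_intCast_padicComplex]
    exact Padic.norm_int_le_one _
  · obtain ⟨m, hm⟩ := exists_norm_coeff_eq_one hg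
    rw [← hm, hcoeff m, norm_mul]
    exact mul_le_of_le_one_right (norm_nonneg _)
      (mem_unitBall_iff.1 ((integralFactor α).coeff m).2)

open Classical in
theorem map_residueField_eq :
    g.map (Int.castRingHom (ResidueField (unitBall ℂ_[p]))) =
      C (reduction (c * ∏ i with 1 < ‖α i‖, α i) *
        (-1) ^ (Finset.univ.filter fun i => ¬ ‖α i‖ ≤ 1).card) *
        ∏ i with ‖α i‖ ≤ 1, (X - C (reduction (α i))) := by
  have hN := norm_leading_mul_prod_eq_one hg hfac
  set N := c * ∏ i with 1 < ‖α i‖, α i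
  have h1 : g.map (Int.castRingHom (unitBall ℂ_[p])) = C (toUnitBall N) * integralFactor α := by
    refine map_injective (unitBall ℂ_[p]).subtype Subtype.val_injective ?_
    rw [Polynomial.map_map, Polynomial.map_mul, map_C, ValuationSubring.subtype_apply,
      coe_toUnitBall hN.le, C_mul_map_integralFactor, ← hfac]
    congr 1
  have h2 := congrArg (Polynomial.map (residue (unitBall ℂ_[p]))) h1
  rw [Polynomial.map_map, Polynomial.map_mul, map_C, map_residue_integralFactor, ← mul_assoc,
    ← C_mul] at h2
  rw [← show (residue (unitBall ℂ_[p])).comp (Int.castRingHom _) = Int.castRingHom _ from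
    RingHom.ext_int _ _]
  exact h2

open Classical in
/-- The residue class is, up to sign, the leading coefficient of `g` modulo `p`, an element of the
prime field. -/
theorem reduction_leading_mul_prod_pow_prime :
    reduction (c * ∏ i with 1 < ‖α i‖, α i) ^ p = reduction (c * ∏ i with 1 < ‖α i‖, α i) := by
  have h := map_residueField_eq hg hfac
  set N := c * ∏ i with 1 < ‖α i‖, α i
  set b := (Finset.univ.filter fun i => ¬ ‖α i‖ ≤ 1).card
  have hmonic : (∏ i with ‖α i‖ ≤ 1, (X - C (reduction (α i)))).Monic :=
    monic_prod_of_monic _ _ fun i _ => monic_X_sub_C _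
  have h1 := congrArg (fun q => q.coeff
    (∏ i with ‖α i‖ ≤ 1, (X - C (reduction (α i)))).natDegree) h
  simp only [coeff_map, coeff_C_mul] at h1
  rw [hmonic.coeff_natDegree, mul_one] at h1
  obtain ⟨z, hz⟩ : ∃ z : ℤ, reduction N = (z : ResidueField (unitBall ℂ_[p])) := by
    refine ⟨g.coeff (∏ i with ‖α i‖ ≤ 1, (X - C (reduction (α i)))).natDegree * (-1) ^ b, ?_⟩
    push_cast
    rw [eq_intCast] at h1
    rw [h1, mul_assoc, ← mul_pow]
    simp
  rw [hz]
  exact map_intCast (frobenius (ResidueField (unitBall ℂ_[p])) p) z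

open Classical in
/-- The Frobenius permutes the roots of a polynomial over the prime field. -/
theorem map_reduction_pow_prime_pow (n : ℕ) :
    (Finset.univ.filter fun i => ‖α i‖ ≤ 1).val.map (fun i => reduction (α i) ^ p ^ n) =
      (Finset.univ.filter fun i => ‖α i‖ ≤ 1).val.map (fun i => reduction (α i)) := by
  have hN := norm_leading_mul_prod_eq_one hg hfac
  have h := map_residueField_eq hg hfac
  set N := c * ∏ i with 1 < ‖α i‖, α i
  set b := (Finset.univ.filter fun i => ¬ ‖α i‖ ≤ 1).card
  have hu : reduction N * (-1) ^ b ≠ 0 := by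
    refine mul_ne_zero ?_ (pow_ne_zero _ (neg_ne_zero.2 one_ne_zero))
    rw [Ne, reduction_eq_zero_iff hN.le, hN]
    exact lt_irrefl _
  have hroots : ∀ r : ι → ResidueField (unitBall ℂ_[p]),
      (∏ i with ‖α i‖ ≤ 1, (X - C (r i))).roots =
        (Finset.univ.filter fun i => ‖α i‖ ≤ 1).val.map r := by
    intro r
    rw [← roots_multiset_prod_X_sub_C (Multiset.map r _), Multiset.map_map]
    rfl
  have h1 := congrArg roots h
  rw [roots_C_mul _ hu, hroots] at h1
  have h2 := congrArg (fun q => (q.map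
    (iterateFrobenius (ResidueField (unitBall ℂ_[p])) p n)).roots) h
  simp only [Polynomial.map_mul, map_C, Polynomial.map_prod, Polynomial.map_sub, map_X] at h2
  rw [roots_C_mul _ ((_root_.map_ne_zero _).2 hu), hroots, Polynomial.map_map,
    show (iterateFrobenius (ResidueField (unitBall ℂ_[p])) p n).comp (Int.castRingHom _) =
      Int.castRingHom _ from RingHom.ext_int _ _, h1] at h2
  exact h2.symm

theorem existsUnique_isClosestRootOfUnity_root {i : ι} (hi : ‖α i‖ = 1) :
    ∃! ζ, IsClosestRootOfUnity p (α i) ζ := by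
  classical
  set x := reduction (α i) with hx
  -- the iterated Frobenius images of `x` lie in a finite set
  have hmem : ∀ n : ℕ, x ^ p ^ n ∈
      ((Finset.univ.filter fun i => ‖α i‖ ≤ 1).val.map (fun i => reduction (α i))).toFinset := by
    intro n
    rw [Multiset.mem_toFinset, ← map_reduction_pow_prime_pow hg hfac n]
    exact Multiset.mem_map_of_mem (fun i => reduction (α i) ^ p ^ n) (by simp [hi])
  obtain ⟨a, b, hab, heq⟩ : ∃ a b : ℕ, a < b ∧ x ^ p ^ a = x ^ p ^ b := by
    obtain ⟨a, b, hne, heq⟩ := Finite.exists_ne_map_eq_of_infinite (fun n => (⟨_, hmem n⟩ :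
      ((Finset.univ.filter fun i => ‖α i‖ ≤ 1).val.map (fun i => reduction (α i))).toFinset))
    have heq' : x ^ p ^ a = x ^ p ^ b := congrArg Subtype.val heq
    rcases lt_or_gt_of_ne hne with h | h
    · exact ⟨a, b, h, heq'⟩
    · exact ⟨b, a, h, heq'.symm⟩
  refine existsUnique_isClosestRootOfUnity_of_reduction_pow_eq hi (e := b - a) (by omega) ?_
  refine (iterateFrobenius (ResidueField (unitBall ℂ_[p])) p a).injective ?_
  rw [iterateFrobenius_def, iterateFrobenius_def, ← hx, ← pow_mul, ← pow_add,
    Nat.sub_add_cancel hab.le, heq]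

open Classical in
/-- The Frobenius `ζ ↦ ζ ^ p` permutes the roots of unity closest to the roots of `g`. The product
is a function of the residue classes, which are permuted. -/
theorem prod_closestRootOfUnity_pow_sub_one {ζ : ι → ℂ_[p]}
    (hζ : ∀ i, ‖α i‖ = 1 → IsClosestRootOfUnity p (α i) (ζ i)) (n : ℕ) :
    ∏ i with ‖α i‖ = 1 ∧ ‖α i - 1‖ = 1, (ζ i ^ p ^ n - 1) =
      ∏ i with ‖α i‖ = 1 ∧ ‖α i - 1‖ = 1, (ζ i - 1) := by
  -- `F` sends the residue class of a root of unity `ζ ≠ 1` to `ζ - 1`, all other classes to `1`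
  let F : ResidueField (unitBall ℂ_[p]) → ℂ_[p] := fun x =>
    if h : x ≠ 1 ∧ ∃ ζ, IsPPrimeRootOfUnity p ζ ∧ reduction ζ = x then h.2.choose - 1 else 1
  have hF : ∀ ζ : ℂ_[p], IsPPrimeRootOfUnity p ζ → ζ ≠ 1 → F (reduction ζ) = ζ - 1 := by
    intro ζ h hne
    have hne' : reduction ζ ≠ 1 := by
      rw [← reduction_one, Ne, reduction_eq_iff h.norm_eq_one.le norm_one.le]
      exact fun h1 => hne (h.eq_of_norm_sub_lt_one isPPrimeRootOfUnity_one h1)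
    have hex : reduction ζ ≠ 1 ∧ ∃ ζ', IsPPrimeRootOfUnity p ζ' ∧ reduction ζ' = reduction ζ :=
      ⟨hne', ζ, h, rfl⟩
    simp only [F, dif_pos hex]
    rw [hex.2.choose_spec.1.eq_of_norm_sub_lt_one h]
    rw [← reduction_eq_iff hex.2.choose_spec.1.norm_eq_one.le h.norm_eq_one.le]
    exact hex.2.choose_spec.2
  have hF1 : F 1 = 1 := dif_neg fun h => h.1 rfl
  have hF0 : F 0 = 1 := by
    refine dif_neg ?_
    rintro ⟨-, ζ, h, h0⟩
    rw [reduction_eq_zero_iff h.norm_eq_one.le, h.norm_eq_one] at h0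
    exact lt_irrefl _ h0
  have key : ∀ n : ℕ, ∏ i with ‖α i‖ = 1 ∧ ‖α i - 1‖ = 1, (ζ i ^ p ^ n - 1) =
      ∏ i with ‖α i‖ ≤ 1, F (reduction (α i) ^ p ^ n) := by
    intro n
    rw [Finset.prod_filter, Finset.prod_filter]
    refine Finset.prod_congr rfl fun i _ => ?_
    have hpn : p ^ n ≠ 0 := pow_ne_zero _ hp.out.ne_zero
    rcases lt_trichotomy ‖α i‖ 1 with hlt | heq | hgt
    · rw [if_neg (fun h => hlt.ne h.1), if_pos hlt.le, (reduction_eq_zero_iff hlt.le).2 hlt,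
        zero_pow hpn, hF0]
    · have h := hζ i heq
      have hred : reduction (α i) = reduction (ζ i) :=
        (reduction_eq_iff heq.le h.1.norm_eq_one.le).2 h.2
      rw [if_pos heq.le, hred]
      by_cases h1 : ζ i = 1
      · rw [if_neg (fun h' => (h.eq_one_iff.1 h1).ne h'.2), h1, reduction_one, one_pow, hF1]
      · have hle : ‖α i - 1‖ ≤ 1 := by
          rw [sub_eq_add_neg]
          refine (IsUltrametricDist.norm_add_le_max _ _).trans ?_
          simp [heq]
        rw [if_pos ⟨heq, le_antisymm hle (not_lt.1 fun hlt => h1 (h.eq_one_iff.2 hlt))⟩,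
          ← reduction_pow h.1.norm_eq_one.le, hF _ (h.1.pow _) (h.1.pow_prime_pow_ne_one h1 n)]
    · rw [if_neg (fun h => hgt.ne' h.1), if_neg (not_le.2 hgt)]
  have h0 := key 0
  simp only [pow_zero, pow_one] at h0
  rw [key n, h0]
  have h1 := congrArg (fun s => (Multiset.map F s).prod) (map_reduction_pow_prime_pow hg hfac n)
  simp only [Multiset.map_map] at h1
  exact h1

end Primitive

end

section

variable {p : ℕ} [hp : Fact p.Prime]

/-! ### Asymptotics of the cyclic resultants -/

theorem norm_sub_one_le_one {x : ℂ_[p]} (hx : ‖x‖ ≤ 1) : ‖x - 1‖ ≤ 1 := by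
  rw [sub_eq_add_neg]
  refine (IsUltrametricDist.norm_add_le_max _ _).trans ?_
  simp [hx]

/-- In the residue field, of characteristic `p`, raising to the power `p ^ n` is injective. -/
theorem norm_sub_one_lt_one_of_pow_eq_one {x : ℂ_[p]} {n : ℕ} (h : x ^ p ^ n = 1) :
    ‖x - 1‖ < 1 := by
  have hx : ‖x‖ = 1 := by
    have h1 := congrArg norm h
    rw [norm_pow, norm_one] at h1
    exact (pow_eq_one_iff_of_nonneg (norm_nonneg _) (pow_ne_zero _ hp.out.ne_zero)).1 h1
  rw [← reduction_eq_iff hx.le norm_one.le, reduction_one]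
  refine (iterateFrobenius (IsLocalRing.ResidueField (unitBall ℂ_[p])) p n).injective ?_
  rw [iterateFrobenius_def, ← reduction_pow hx.le, h, reduction_one, map_one]

theorem neg_one_pow_prime_pow {n : ℕ} (hn : 1 ≤ n) (d : ℕ) :
    (-1 : ℂ_[p]) ^ (p ^ n * d) = (-1) ^ (p * d) := by
  rw [pow_mul, pow_mul]
  congr 1
  rcases hp.out.eq_two_or_odd' with h2 | hodd
  · have he : Even p := h2 ▸ even_two
    rw [he.neg_one_pow, (he.pow_of_ne_zero (by omega)).neg_one_pow]
  · rw [hodd.neg_one_pow, hodd.pow.neg_one_pow]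

theorem cyclicResultant_eq_prod {f : ℤ[X]} {c : ℂ_[p]} {α : Fin f.natDegree → ℂ_[p]}
    (hfac : f.map (Int.castRingHom ℂ_[p]) = C c * ∏ i, (X - C (α i))) (n : ℕ) :
    (cyclicResultant p n f : ℂ_[p]) =
      c ^ p ^ n * ((-1) ^ (p ^ n * f.natDegree) * ∏ i, (α i ^ p ^ n - 1)) := by
  have hdeg : (X ^ p ^ n - 1 : ℤ[X]).natDegree = p ^ n := natDegree_X_pow_sub_C (r := 1)
  have hdeg' : (X ^ p ^ n - 1 : ℂ_[p][X]).natDegree = p ^ n := natDegree_X_pow_sub_C (r := 1)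
  have hmap : (X ^ p ^ n - 1 : ℤ[X]).map (Int.castRingHom ℂ_[p]) = X ^ p ^ n - 1 := by simp
  have hprod : (∏ i, (X - C (α i))).natDegree = f.natDegree := by
    rw [natDegree_finsetProd_X_sub_C_eq_card, Finset.card_univ, Fintype.card_fin]
  rw [cyclicResultant, ← eq_intCast (Int.castRingHom ℂ_[p]), ← resultant_map_map, hdeg, hfac,
    resultant_C_mul_right, hmap]
  congr 1
  have hres := resultant_prod_right Finset.univ (X ^ p ^ n - 1) (fun i => X - C (α i)) _ hdeg'.le
    (by simp)
  rw [hprod] at hres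
  rw [hres]
  simp only [natDegree_X_sub_C, resultant_X_sub_C_right _ _ _ hdeg'.le]
  rw [Finset.prod_mul_distrib, Finset.prod_const, Finset.card_univ, Fintype.card_fin, ← pow_mul]
  simp

theorem IsClosestRootOfUnity.pow_prime_eq {a ξ : ℂ_[p]} (h : IsClosestRootOfUnity p a ξ)
    (ha : reduction a ^ p = reduction a) : ξ ^ p = ξ := by
  have hred : reduction a = reduction ξ :=
    (reduction_eq_iff h.norm_eq_one.le h.1.norm_eq_one.le).2 h.2
  refine (h.1.pow p).eq_of_norm_sub_lt_one h.1 ?_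
  rw [← reduction_eq_iff (h.1.pow p).norm_eq_one.le h.1.norm_eq_one.le,
    reduction_pow h.1.norm_eq_one.le, ← hred, ha]

theorem IsClosestRootOfUnity.tendsto_pow {a ξ : ℂ_[p]} (h : IsClosestRootOfUnity p a ξ)
    (ha : reduction a ^ p = reduction a) : Tendsto (fun n => a ^ p ^ n) atTop (𝓝 ξ) := by
  have hpow : ∀ n : ℕ, ξ ^ p ^ n = ξ := by
    intro n
    induction n with
    | zero => simp
    | succ n ih => rw [pow_succ, pow_mul, ih, h.pow_prime_eq ha]
  have h1 := h.tendsto_div.mul_const ξ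
  rw [one_mul] at h1
  refine h1.congr fun n => ?_
  rw [hpow, div_mul_cancel₀ _ h.1.ne_zero]

open Classical in
/-- The elementary approximation to `x ^ p ^ n - 1` in each of the four cases: `-1` for `‖x‖ < 1`,
`x ^ p ^ n` for `1 < ‖x‖`, `p ^ n` for `‖x - 1‖ < 1`, and otherwise `z ^ p ^ n - 1`, where `z` is
the root of unity closest to `x`. It is written as a product so that the product over all roots
splits. -/
noncomputable def mainPart (x z : ℂ_[p]) (n : ℕ) : ℂ_[p] :=
  (if ‖x‖ < 1 then -1 else 1) * (if 1 < ‖x‖ then x ^ p ^ n else 1) *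
    (if ‖x - 1‖ < 1 then (p : ℂ_[p]) ^ n else 1) *
    (if ‖x‖ = 1 ∧ ‖x - 1‖ = 1 then z ^ p ^ n - 1 else 1)

theorem tendsto_pow_prime_pow_zero {x : ℂ_[p]} (hx : ‖x‖ < 1) :
    Tendsto (fun n => x ^ p ^ n) atTop (𝓝 0) :=
  (tendsto_pow_atTop_nhds_zero_of_norm_lt_one hx).comp
    (tendsto_pow_atTop_atTop_of_one_lt hp.out.one_lt)

open Classical in
/-- Up to the factor `mainPart x z n`, the quantity `x ^ p ^ n - 1` converges to a limit that only
sees the logarithm. -/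
theorem tendsto_pow_sub_one_div_mainPart {x z : ℂ_[p]}
    (hz : ‖x‖ = 1 → IsClosestRootOfUnity p x z) :
    Tendsto (fun n => (x ^ p ^ n - 1) / mainPart x z n) atTop
      (𝓝 (if ‖x‖ = 1 ∧ ‖x - 1‖ < 1 then padicLog p x else 1)) ∧ ∀ n, mainPart x z n ≠ 0 := by
  rcases lt_trichotomy ‖x‖ 1 with hlt | heq | hgt
  · have h1 : ¬ ‖x - 1‖ < 1 := fun h => hlt.ne (norm_eq_one_of_norm_sub_lt norm_one h)
    simp only [mainPart, if_pos hlt, if_neg hlt.not_gt, if_neg h1, hlt.ne, false_and, if_false,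
      mul_one]
    refine ⟨?_, fun _ => neg_ne_zero.2 one_ne_zero⟩
    simpa using ((tendsto_pow_prime_pow_zero hlt).sub_const 1).div_const (-1)
  · by_cases h1 : ‖x - 1‖ < 1
    · simp only [mainPart, heq, lt_irrefl, if_false, if_pos h1, h1.ne, and_false, true_and,
        mul_one, one_mul]
      exact ⟨tendsto_padicLog p h1, fun n => pow_ne_zero _ (prime_padicComplex_ne_zero p)⟩
    · have h2 : ‖x - 1‖ = 1 := le_antisymm (norm_sub_one_le_one heq.le) (not_lt.1 h1)
      have hz1 : z ≠ 1 := fun h => h1 ((hz heq).eq_one_iff.1 h)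
      simp only [mainPart, heq, h2, lt_irrefl, if_false, and_false, true_and, if_true, one_mul]
      exact ⟨(hz heq).tendsto_sub_one_div hz1,
        fun n => sub_ne_zero.2 ((hz heq).1.pow_prime_pow_ne_one hz1 n)⟩
  · have h1 : ¬ ‖x - 1‖ < 1 := fun h => hgt.ne' (norm_eq_one_of_norm_sub_lt norm_one h)
    have h0 : x ≠ 0 := norm_ne_zero_iff.1 (by linarith)
    simp only [mainPart, if_neg hgt.not_gt, if_pos hgt, if_neg h1, hgt.ne', false_and, if_false,
      mul_one, one_mul]
    refine ⟨?_, fun _ => pow_ne_zero _ h0⟩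
    have h2 := (tendsto_pow_prime_pow_zero (x := x⁻¹)
      (by rw [norm_inv]; exact inv_lt_one_of_one_lt₀ hgt)).const_sub 1
    rw [sub_zero] at h2
    refine h2.congr fun n => ?_
    have := pow_ne_zero (p ^ n) h0
    rw [inv_pow]
    field_simp

theorem cast_nonPPart_padicComplex (r : ℤ) :
    (nonPPart p r : ℂ_[p]) = r / (p : ℂ_[p]) ^ padicValInt p r := by
  rw [nonPPart, Int.cast_div (padicValInt_dvd r)
    (by push_cast; exact pow_ne_zero _ (prime_padicComplex_ne_zero p))]
  push_cast
  rfl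

/-- `ℤ_[p]` is complete, so integers that converge in `ℂ_[p]` converge in `ℤ_[p]`. -/
theorem exists_tendsto_padicInt {z : ℕ → ℤ} {L : ℂ_[p]}
    (h : Tendsto (fun n => (z n : ℂ_[p])) atTop (𝓝 L)) :
    ∃ L' : ℤ_[p], Tendsto (fun n => (z n : ℤ_[p])) atTop (𝓝 L') ∧
      algebraMap ℚ_[p] ℂ_[p] L' = L := by
  let φ : ℤ_[p] → ℂ_[p] := fun x => algebraMap ℚ_[p] ℂ_[p] x
  have hφ : Topology.IsClosedEmbedding φ := by
    refine Isometry.isClosedEmbedding (Isometry.of_dist_eq fun x y => ?_)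
    rw [dist_eq_norm, dist_eq_norm, ← map_sub, norm_algebraMap', ← PadicInt.coe_sub]
    rfl
  have hz : ∀ n, φ (z n) = (z n : ℂ_[p]) := by
    intro n
    simp [φ]
  obtain ⟨L', hL'⟩ : L ∈ Set.range φ :=
    hφ.isClosed_range.mem_of_tendsto h (Eventually.of_forall fun n => ⟨z n, hz n⟩)
  refine ⟨L', hφ.tendsto_nhds_iff.2 ?_, hL'⟩
  rw [hL']
  exact h.congr fun n => (hz n).symm

theorem tendsto_padicInt_zero {z : ℕ → ℤ}
    (h : Tendsto (fun n => (z n : ℂ_[p])) atTop (𝓝 0)) :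
    Tendsto (fun n => (z n : ℤ_[p])) atTop (𝓝 0) := by
  obtain ⟨L, hL, h0⟩ := exists_tendsto_padicInt h
  have h0' : (L : ℚ_[p]) = 0 := by simpa using h0
  rwa [PadicInt.ext (x := L) (y := 0) (by simpa using h0')] at hL

theorem limitSign_ne_zero {d : ℕ} (α : Fin d → ℂ_[p]) : limitSign p α ≠ 0 :=
  pow_ne_zero _ (neg_ne_zero.2 one_ne_zero)

theorem norm_limitSign {d : ℕ} (α : Fin d → ℂ_[p]) : ‖limitSign p α‖ = 1 := by
  rw [limitSign, norm_pow, norm_neg, norm_one, one_pow]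

section Factored

variable {f g : ℤ[X]} {μ : ℕ} (hfg : f = C ((p : ℤ) ^ μ) * g)
  (hg : ¬ C (p : ℤ) ∣ g) {c : ℂ_[p]} {α : Fin f.natDegree → ℂ_[p]}
  (hfac : f.map (Int.castRingHom ℂ_[p]) = C c * ∏ i, (X - C (α i)))

include hfg hfac in
theorem map_primitive_eq : g.map (Int.castRingHom ℂ_[p]) =
    C ((p : ℂ_[p]) ^ (-(μ : ℤ)) * c) * ∏ i, (X - C (α i)) := by
  have hpμ : (p : ℂ_[p]) ^ μ ≠ 0 := pow_ne_zero _ (prime_padicComplex_ne_zero p)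
  rw [C_mul, mul_assoc, ← hfac, hfg, Polynomial.map_mul, map_C, ← mul_assoc, ← C_mul]
  simp [hpμ]

theorem prime_pow_mul_normalizedLeadingTerm {d : ℕ} (μ : ℕ) (c : ℂ_[p]) (α : Fin d → ℂ_[p]) :
    (p : ℂ_[p]) ^ μ * normalizedLeadingTerm p μ c α = c * ∏ i with 1 < ‖α i‖, α i := by
  have hpμ : (p : ℂ_[p]) ^ μ ≠ 0 := pow_ne_zero _ (prime_padicComplex_ne_zero p)
  rw [normalizedLeadingTerm, zpow_neg, zpow_natCast, ← mul_assoc, ← mul_assoc,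
    mul_inv_cancel₀ hpμ, one_mul]

include hfg hg hfac

theorem norm_normalizedLeadingTerm : ‖normalizedLeadingTerm p μ c α‖ = 1 :=
  norm_leading_mul_prod_eq_one hg (map_primitive_eq hfg hfac)

theorem reduction_normalizedLeadingTerm_pow :
    reduction (normalizedLeadingTerm p μ c α) ^ p =
      reduction (normalizedLeadingTerm p μ c α) :=
  reduction_leading_mul_prod_pow_prime hg (map_primitive_eq hfg hfac)

open Classical in
/-- The common asymptotic behind all cases: each root with `‖α i - 1‖ < 1` contributes a factor
`p ^ n` to the resultant, and the content of `f` contributes `p ^ (μ * p ^ n)`. -/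
theorem tendsto_cyclicResultant_div {ξ : ℂ_[p]} {ζ : Fin f.natDegree → ℂ_[p]}
    (hξ : IsClosestRootOfUnity p (normalizedLeadingTerm p μ c α) ξ)
    (hζ : ∀ i, ‖α i‖ = 1 → IsClosestRootOfUnity p (α i) (ζ i)) :
    Tendsto (fun n => (cyclicResultant p n f : ℂ_[p]) / (p : ℂ_[p]) ^
      (μ * p ^ n + n * (Finset.univ.filter fun i => ‖α i - 1‖ < 1).card)) atTop
      (𝓝 (limitSign p α * ξ * (∏ i with ‖α i‖ = 1 ∧ ‖α i - 1‖ = 1, (ζ i - 1)) *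
        ∏ i with ‖α i‖ = 1 ∧ ‖α i - 1‖ < 1, padicLog p (α i))) := by
  have h1 := ((hξ.tendsto_pow (reduction_normalizedLeadingTerm_pow hfg hg hfac)).const_mul
    (limitSign p α)).mul_const (∏ i with ‖α i‖ = 1 ∧ ‖α i - 1‖ = 1, (ζ i - 1))
  have h2 := tendsto_finsetProd Finset.univ
    fun i _ => (tendsto_pow_sub_one_div_mainPart (hζ i)).1
  rw [← Finset.prod_filter] at h2
  refine (h1.mul h2).congr' ?_
  filter_upwards [eventually_ge_atTop 1] with n hn
  have hp0 : ∀ m, (p : ℂ_[p]) ^ m ≠ 0 := fun m => pow_ne_zero _ (prime_padicComplex_ne_zero p)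
  have hmain : ∏ i, (α i ^ p ^ n - 1) = (∏ i, (α i ^ p ^ n - 1) / mainPart (α i) (ζ i) n) *
      ∏ i, mainPart (α i) (ζ i) n := by
    rw [← Finset.prod_mul_distrib]
    exact Finset.prod_congr rfl fun i _ =>
      (div_mul_cancel₀ _ ((tendsto_pow_sub_one_div_mainPart (hζ i)).2 n)).symm
  have hmain' : ∏ i, mainPart (α i) (ζ i) n =
      (-1) ^ (Finset.univ.filter fun i => ‖α i‖ < 1).card *
        (∏ i with 1 < ‖α i‖, α i) ^ p ^ n *
        ((p : ℂ_[p]) ^ n) ^ (Finset.univ.filter fun i => ‖α i - 1‖ < 1).card *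
        ∏ i with ‖α i‖ = 1 ∧ ‖α i - 1‖ = 1, (ζ i - 1) := by
    simp only [mainPart]
    rw [Finset.prod_mul_distrib, Finset.prod_mul_distrib, Finset.prod_mul_distrib,
      ← Finset.prod_filter, ← Finset.prod_filter, ← Finset.prod_filter, ← Finset.prod_filter,
      Finset.prod_const, Finset.prod_const, Finset.prod_pow,
      prod_closestRootOfUnity_pow_sub_one hg (map_primitive_eq hfg hfac) hζ]
  have hN := congrArg (· ^ p ^ n) (prime_pow_mul_normalizedLeadingTerm μ c α)
  simp only [mul_pow, ← pow_mul] at hN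
  rw [eq_div_iff (hp0 _), cyclicResultant_eq_prod hfac, hmain, hmain', neg_one_pow_prime_pow hn,
    limitSign, pow_add, pow_add, ← pow_mul (p : ℂ_[p]) n]
  linear_combination (∏ i, (α i ^ p ^ n - 1) / mainPart (α i) (ζ i) n) *
    (-1) ^ (p * f.natDegree) * (-1) ^ (Finset.univ.filter fun i => ‖α i‖ < 1).card *
    (p : ℂ_[p]) ^ (n * (Finset.univ.filter fun i => ‖α i - 1‖ < 1).card) *
    (∏ i with ‖α i‖ = 1 ∧ ‖α i - 1‖ = 1, (ζ i - 1)) * hN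

open Classical in
theorem norm_eval_one : ‖((f.eval 1 : ℤ) : ℚ_[p])‖ =
    ‖(p : ℂ_[p]) ^ μ‖ * ∏ i with ‖α i - 1‖ < 1, ‖α i - 1‖ := by
  have h1 : ((f.eval 1 : ℤ) : ℂ_[p]) = c * ∏ i, (1 - α i) := by
    have h := congrArg (eval 1) hfac
    rw [eval_map] at h
    rw [← eq_intCast (Int.castRingHom ℂ_[p]), ← eval₂_at_apply, map_one, h]
    simp [eval_prod]
  have h2 : ∀ i, ‖1 - α i‖ =
      (if 1 < ‖α i‖ then ‖α i‖ else 1) * (if ‖α i - 1‖ < 1 then ‖α i - 1‖ else 1) := by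
    intro i
    rw [norm_sub_rev]
    by_cases hgt : 1 < ‖α i‖
    · have h3 : ‖α i - 1‖ = ‖α i‖ := norm_eq_of_norm_sub_lt (by simpa using hgt)
      rw [if_pos hgt, h3, if_neg hgt.not_gt, mul_one]
    · rw [if_neg hgt, one_mul]
      split_ifs with h
      · rfl
      · exact le_antisymm (norm_sub_one_le_one (not_lt.1 hgt)) (not_lt.1 h)
  have h3 : ‖c‖ * ∏ i with 1 < ‖α i‖, ‖α i‖ = ‖(p : ℂ_[p]) ^ μ‖ := by
    rw [← norm_prod, ← norm_mul, ← prime_pow_mul_normalizedLeadingTerm μ c α, norm_mul,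
      norm_normalizedLeadingTerm hfg hg hfac, mul_one]
  rw [← norm_intCast_padicComplex, h1, norm_mul, norm_prod, Finset.prod_congr rfl fun i _ => h2 i,
    Finset.prod_mul_distrib, ← Finset.prod_filter, ← Finset.prod_filter, ← mul_assoc, h3]

end Factored

end

section

variable {p : ℕ} [hp : Fact p.Prime]

theorem norm_intCast_eq_zpow {r : ℤ} (hr : r ≠ 0) :
    ‖(r : ℂ_[p])‖ = (p : ℝ) ^ (-(padicValInt p r : ℤ)) := by
  rw [norm_intCast_padicComplex, Padic.norm_eq_zpow_neg_valuation (by exact_mod_cast hr),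
    Padic.valuation_intCast]

theorem norm_prime_pow (m : ℕ) : ‖(p : ℂ_[p]) ^ m‖ = (p : ℝ) ^ (-(m : ℤ)) := by
  rw [norm_pow, norm_prime_padicComplex, inv_pow, zpow_neg, zpow_natCast]

/-- The absolute values of `r n / p ^ e n` are eventually equal to `‖L‖`; this makes `‖L‖` a power
`p ^ (-ν)` and determines the valuation `e n + ν` of `r n` for large `n`. -/
theorem exists_tendsto_nonPPart_of_tendsto_div {r : ℕ → ℤ} (hr : ∀ n, r n ≠ 0) {e : ℕ → ℕ}
    {L : ℂ_[p]} (hL : L ≠ 0)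
    (h : Tendsto (fun n => (r n : ℂ_[p]) / (p : ℂ_[p]) ^ e n) atTop (𝓝 L)) :
    ∃ ν : ℤ, (p : ℝ) ^ (-ν) = ‖L‖ ∧ ∃ L' : ℤ_[p],
      Tendsto (fun n => (nonPPart p (r n) : ℤ_[p])) atTop (𝓝 L') ∧
      algebraMap ℚ_[p] ℂ_[p] L' = L * (p : ℂ_[p]) ^ (-ν) := by
  have hp0 := prime_padicComplex_ne_zero p
  have hpR : (0 : ℝ) < p := by exact_mod_cast hp.out.pos
  have hpR1 : (p : ℝ) ≠ 1 := by exact_mod_cast hp.out.ne_one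
  have hev : ∀ᶠ n in atTop, (p : ℝ) ^ (-((padicValInt p (r n) : ℤ) - e n)) = ‖L‖ := by
    have h1 := (tendsto_iff_norm_sub_tendsto_zero.1 h).eventually_lt_const (norm_pos_iff.2 hL)
    filter_upwards [h1] with n hn
    rw [← norm_eq_of_norm_sub_lt hn, norm_div, norm_intCast_eq_zpow (hr n), norm_prime_pow,
      ← zpow_sub₀ hpR.ne']
    congr 1
    ring
  obtain ⟨n₀, hn₀⟩ := hev.exists
  refine ⟨(padicValInt p (r n₀) : ℤ) - e n₀, hn₀, exists_tendsto_padicInt ?_⟩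
  refine (h.mul_const _).congr' ?_
  filter_upwards [hev] with n hn
  have hv : (padicValInt p (r n) : ℤ) - e n = padicValInt p (r n₀) - e n₀ :=
    neg_injective (zpow_right_injective₀ hpR hpR1 (hn.trans hn₀.symm))
  rw [← hv, cast_nonPPart_padicComplex, neg_sub, zpow_sub₀ hp0, zpow_natCast, zpow_natCast,
    div_mul_div_cancel₀ (pow_ne_zero _ hp0)]

section Factored

variable {f g : ℤ[X]} {μ : ℕ} (hfg : f = C ((p : ℤ) ^ μ) * g) (hg : ¬ C (p : ℤ) ∣ g)
  {c : ℂ_[p]} {α : Fin f.natDegree → ℂ_[p]}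
  (hfac : f.map (Int.castRingHom ℂ_[p]) = C c * ∏ i, (X - C (α i)))
  {ξ : ℂ_[p]} {ζ : Fin f.natDegree → ℂ_[p]}
  (hξ : IsClosestRootOfUnity p (normalizedLeadingTerm p μ c α) ξ)
  (hζ : ∀ i, ‖α i‖ = 1 → IsClosestRootOfUnity p (α i) (ζ i))

/-! ### Limits of the cyclic resultants -/

include hfac in
theorem cyclicResultant_eq_zero_of_pow_eq_one {i : Fin f.natDegree} {m n : ℕ} (hmn : m ≤ n)
    (h : α i ^ p ^ m = 1) : cyclicResultant p n f = 0 := by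
  have h1 : α i ^ p ^ n - 1 = 0 := by
    obtain ⟨k, rfl⟩ := Nat.exists_eq_add_of_le hmn
    simp [pow_add, pow_mul, h]
  have h2 := cyclicResultant_eq_prod hfac n
  rw [Finset.prod_eq_zero (Finset.mem_univ i) h1, mul_zero, mul_zero] at h2
  exact_mod_cast h2

include hfac in
theorem exists_pow_eq_one_of_cyclicResultant_eq_zero (hf : f ≠ 0) {n : ℕ}
    (h : cyclicResultant p n f = 0) : ∃ i, α i ^ p ^ n = 1 := by
  have hc : c ≠ 0 := by
    rintro rfl
    rw [C_0, zero_mul, Polynomial.map_eq_zero_iff (RingHom.injective_int _)] at hfac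
    exact hf hfac
  have h2 := cyclicResultant_eq_prod hfac n
  rw [h, Int.cast_zero, eq_comm, mul_eq_zero, mul_eq_zero, Finset.prod_eq_zero_iff] at h2
  obtain ⟨i, -, hi⟩ := (h2.resolve_left (pow_ne_zero _ hc)).resolve_left
    (pow_ne_zero _ (neg_ne_zero.2 one_ne_zero))
  exact ⟨i, sub_eq_zero.1 hi⟩

include hfac in
theorem padicLog_root_ne_zero (hr : ∀ n : ℕ, cyclicResultant p n f ≠ 0) {i : Fin f.natDegree}
    (hi : ‖α i - 1‖ < 1) : padicLog p (α i) ≠ 0 := by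
  intro h
  obtain ⟨m, hm⟩ := exists_pow_eq_one_of_padicLog_eq_zero p hi h
  exact hr m (cyclicResultant_eq_zero_of_pow_eq_one hfac le_rfl hm)

include hξ hζ in
open Classical in
theorem norm_asymptotic_limit : ‖limitSign p α * ξ *
    (∏ i with ‖α i‖ = 1 ∧ ‖α i - 1‖ = 1, (ζ i - 1)) *
      ∏ i with ‖α i‖ = 1 ∧ ‖α i - 1‖ < 1, padicLog p (α i)‖ =
    ∏ i with ‖α i - 1‖ < 1, ‖padicLog p (α i)‖ := by
  have h1 : ∀ i, ‖α i‖ = 1 ∧ ‖α i - 1‖ < 1 ↔ ‖α i - 1‖ < 1 := fun i =>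
    ⟨And.right, fun h => ⟨norm_eq_one_of_norm_sub_lt norm_one h, h⟩⟩
  have h2 : ∏ i with ‖α i‖ = 1 ∧ ‖α i - 1‖ = 1, ‖ζ i - 1‖ = 1 := by
    refine Finset.prod_eq_one fun i hi => ?_
    rw [Finset.mem_filter] at hi
    have h := hζ i hi.2.1
    exact h.1.norm_sub_one fun h1 => (h.eq_one_iff.1 h1).ne hi.2.2
  rw [norm_mul, norm_mul, norm_mul, norm_limitSign, hξ.1.norm_eq_one, norm_prod, norm_prod, h2]
  simp only [h1, one_mul]

include hfg hg hfac hξ hζ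

theorem tendsto_cyclicResultant_zero_of_prime_dvd (hμ : μ ≠ 0) :
    Tendsto (fun n => (cyclicResultant p n f : ℤ_[p])) atTop (𝓝 0) := by
  classical
  refine tendsto_padicInt_zero ?_
  set k := (Finset.univ.filter fun i => ‖α i - 1‖ < 1).card
  have h0 : Tendsto (fun n => (p : ℂ_[p]) ^ (μ * p ^ n + n * k)) atTop (𝓝 0) := by
    refine (tendsto_prime_pow_padicComplex p).comp (tendsto_atTop_mono (fun n => ?_)
      (tendsto_pow_atTop_atTop_of_one_lt hp.out.one_lt))
    exact (Nat.le_mul_of_pos_left _ (Nat.pos_of_ne_zero hμ)).trans (Nat.le_add_right _ _)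
  have h := h0.mul (tendsto_cyclicResultant_div hfg hg hfac hξ hζ)
  rw [zero_mul] at h
  exact h.congr fun n => mul_div_cancel₀ _ (pow_ne_zero _ (prime_padicComplex_ne_zero p))

open Classical in
theorem exists_tendsto_cyclicResultant (hμ : μ = 0) :
    ∃ L : ℤ_[p],
      Tendsto (fun n : ℕ => (cyclicResultant p n f : ℤ_[p])) atTop (𝓝 L) ∧
      algebraMap ℚ_[p] ℂ_[p] L = limitSign p α * ξ * ∏ i with ‖α i‖ = 1, (ζ i - 1) ∧
      (L = 0 ↔ ∃ i, ‖α i‖ = 1 ∧ ζ i = 1) := by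
  have hlim := tendsto_cyclicResultant_div hfg hg hfac hξ hζ
  simp only [hμ, zero_mul, zero_add] at hlim
  have h : Tendsto (fun n => (cyclicResultant p n f : ℂ_[p])) atTop
      (𝓝 (limitSign p α * ξ * ∏ i with ‖α i‖ = 1, (ζ i - 1))) := by
    by_cases hex : ∃ i, ‖α i - 1‖ < 1
    · -- some factor of the product vanishes, and the resultant is divisible by `p ^ n`
      obtain ⟨i, hi⟩ := hex
      have hi1 := norm_eq_one_of_norm_sub_lt norm_one hi
      rw [Finset.prod_eq_zero (i := i) (by simp [hi1])
        (sub_eq_zero.2 ((hζ i hi1).eq_one_iff.2 hi)), mul_zero]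
      have hk : 0 < (Finset.univ.filter fun i => ‖α i - 1‖ < 1).card :=
        Finset.card_pos.2 ⟨i, by simp [hi]⟩
      have h0 : Tendsto (fun n => (p : ℂ_[p]) ^
          (n * (Finset.univ.filter fun i => ‖α i - 1‖ < 1).card)) atTop (𝓝 0) :=
        (tendsto_prime_pow_padicComplex p).comp
          (tendsto_atTop_mono (fun n => Nat.le_mul_of_pos_right _ hk) tendsto_id)
      have h1 := h0.mul hlim
      rw [zero_mul] at h1
      exact h1.congr fun n => mul_div_cancel₀ _ (pow_ne_zero _ (prime_padicComplex_ne_zero p))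
    · push Not at hex
      have h1 : ∀ i, ¬ ‖α i - 1‖ < 1 := fun i => not_lt.2 (hex i)
      have h2 : ∀ i, ‖α i‖ = 1 ∧ ‖α i - 1‖ = 1 ↔ ‖α i‖ = 1 := fun i =>
        ⟨And.left, fun h => ⟨h, le_antisymm (norm_sub_one_le_one h.le) (hex i)⟩⟩
      simpa only [h1, and_false, h2, Finset.filter_false, Finset.card_empty, mul_zero, pow_zero,
        div_one, Finset.prod_empty, mul_one] using hlim
  obtain ⟨L, hL, hLeq⟩ := exists_tendsto_padicInt h
  refine ⟨L, hL, hLeq, ?_⟩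
  rw [← PadicInt.coe_eq_zero, ← map_eq_zero (algebraMap ℚ_[p] ℂ_[p]), hLeq, mul_eq_zero,
    or_iff_right (mul_ne_zero (limitSign_ne_zero α) hξ.1.ne_zero), Finset.prod_eq_zero_iff]
  simp [sub_eq_zero]

/-! ### Limits of the non-`p`-parts -/

open Classical in
theorem exists_tendsto_nonPPart (hr : ∀ n : ℕ, cyclicResultant p n f ≠ 0) :
    ∃ ν : ℤ, (p : ℝ) ^ (-ν) = ∏ i with ‖α i - 1‖ < 1, ‖padicLog p (α i)‖ ∧
      ∃ L : ℤ_[p],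
        Tendsto (fun n : ℕ => (nonPPart p (cyclicResultant p n f) : ℤ_[p])) atTop (𝓝 L) ∧
        algebraMap ℚ_[p] ℂ_[p] L =
          limitSign p α * ξ * (∏ i with ‖α i‖ = 1 ∧ ‖α i - 1‖ = 1, (ζ i - 1)) *
            (p : ℂ_[p]) ^ (-ν) *
            ∏ i with ‖α i‖ = 1 ∧ ‖α i - 1‖ < 1, padicLog p (α i) := by
  have hnorm := norm_asymptotic_limit hξ hζ
  have hL := tendsto_cyclicResultant_div hfg hg hfac hξ hζ
  have hpos : 0 < ∏ i with ‖α i - 1‖ < 1, ‖padicLog p (α i)‖ := Finset.prod_pos fun i hi =>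
    norm_pos_iff.2 (padicLog_root_ne_zero hfac hr (Finset.mem_filter.1 hi).2)
  obtain ⟨ν, hν, L, hlim, hLeq⟩ := exists_tendsto_nonPPart_of_tendsto_div hr
    (norm_pos_iff.1 (hnorm ▸ hpos)) hL
  exact ⟨ν, hν.trans hnorm, L, hlim, hLeq.trans (mul_right_comm _ _ _)⟩

omit hξ hζ

open Classical in
/-- On the disc `‖a - 1‖ < p ^ (-1 / (p - 1))` the logarithm preserves the distance from `1`. -/
theorem zpow_add_eq_inv_norm_eval_one {ν : ℤ}
    (hν : (p : ℝ) ^ (-ν) = ∏ i with ‖α i - 1‖ < 1, ‖padicLog p (α i)‖)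
    (hsmall : ∀ i, ‖α i - 1‖ < 1 → ‖α i - 1‖ < (p : ℝ) ^ (-1 / ((p : ℝ) - 1))) :
    (p : ℝ) ^ ((μ : ℤ) + ν) = ‖((f.eval 1 : ℤ) : ℚ_[p])‖⁻¹ := by
  have hpR : (0 : ℝ) < p := by exact_mod_cast hp.out.pos
  have hp1 : (0 : ℝ) < (p : ℝ) - 1 := sub_pos.2 (by exact_mod_cast hp.out.one_lt)
  have h1 : ∏ i with ‖α i - 1‖ < 1, ‖padicLog p (α i)‖ =
      ∏ i with ‖α i - 1‖ < 1, ‖α i - 1‖ := by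
    refine Finset.prod_congr rfl fun i hi => ?_
    have hi1 := (Finset.mem_filter.1 hi).2
    refine norm_padicLog_eq p hi1 ?_
    have h2 := pow_lt_pow_left₀ (hsmall i hi1) (norm_nonneg _) (Nat.sub_pos_of_lt hp.out.one_lt).ne'
    rwa [← Real.rpow_natCast (_ ^ (_ : ℝ)), ← Real.rpow_mul hpR.le, Nat.cast_sub hp.out.one_le,
      Nat.cast_one, div_mul_cancel₀ _ hp1.ne', Real.rpow_neg_one] at h2
  rw [norm_eval_one hfg hg hfac, ← h1, ← hν, norm_prime_pow, ← zpow_add₀ hpR.ne', ← zpow_neg]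
  congr 1
  ring

omit hfg hg

open Classical in
theorem tendsto_nonPPart_zero (hf : f ≠ 0) {n₀ : ℕ} (h : cyclicResultant p n₀ f = 0) :
    Tendsto (fun n : ℕ => (nonPPart p (cyclicResultant p n f) : ℤ_[p])) atTop (𝓝 0) ∧
      ∏ i with ‖α i‖ = 1 ∧ ‖α i - 1‖ < 1, padicLog p (α i) = 0 := by
  obtain ⟨i, hi⟩ := exists_pow_eq_one_of_cyclicResultant_eq_zero hfac hf h
  have hi1 := norm_sub_one_lt_one_of_pow_eq_one hi
  constructor
  · refine tendsto_const_nhds.congr' ?_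
    filter_upwards [eventually_ge_atTop n₀] with n hn
    rw [cyclicResultant_eq_zero_of_pow_eq_one hfac hn hi]
    simp [nonPPart]
  · exact Finset.prod_eq_zero (i := i) (by simp [hi1, norm_eq_one_of_norm_sub_lt norm_one hi1])
      (padicLog_eq_zero_of_pow_eq_one p hi1 hi)

end Factored

end

open Classical in
theorem theorem4p4 (p : ℕ) [Fact p.Prime]
    -- a fixed embedding of the algebraic numbers into the `p`-adic complex numbers
    (j : AlgebraicClosure ℚ →+* ℂ_[p])
    (f : ℤ[X]) (hf : f ≠ 0)
    -- `p ^ μ` is the maximal power of `p` dividing `f`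
    (μ : ℕ) (hμ : C ((p : ℤ) ^ μ) ∣ f) (hμ_max : ¬ C ((p : ℤ) ^ (μ + 1)) ∣ f)
    -- `f = a₀ * ∏ (t - β_i)` over the algebraic numbers
    (a₀ : AlgebraicClosure ℚ) (β : Fin f.natDegree → AlgebraicClosure ℚ)
    (hfactor : f.map (algebraMap ℤ (AlgebraicClosure ℚ)) = C a₀ * ∏ i, (X - C (β i)))
    -- the roots, seen in the `p`-adic complex numbers
    (α : Fin f.natDegree → ℂ_[p]) (hα : ∀ i, α i = j (β i)) :
    -- the data `ξ` and `ζ_i` are well defined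
    ‖normalizedLeadingTerm p μ (j a₀) α‖ = 1 ∧
    (∃! ξ, IsClosestRootOfUnity p (normalizedLeadingTerm p μ (j a₀) α) ξ) ∧
    (∀ i, ‖α i‖ = 1 → ∃! ζ, IsClosestRootOfUnity p (α i) ζ) ∧
    ∀ (ξ : ℂ_[p]) (ζ : Fin f.natDegree → ℂ_[p]),
      IsClosestRootOfUnity p (normalizedLeadingTerm p μ (j a₀) α) ξ →
      (∀ i, ‖α i‖ = 1 → IsClosestRootOfUnity p (α i) (ζ i)) →
      -- (1) (i)
      (C (p : ℤ) ∣ f →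
        Tendsto (fun n : ℕ => (cyclicResultant p n f : ℤ_[p])) atTop (𝓝 0)) ∧
      -- (1) (ii)
      (¬ C (p : ℤ) ∣ f →
        ∃ L : ℤ_[p],
          Tendsto (fun n : ℕ => (cyclicResultant p n f : ℤ_[p])) atTop (𝓝 L) ∧
          algebraMap ℚ_[p] ℂ_[p] L =
            limitSign p α * ξ * ∏ i with ‖α i‖ = 1, (ζ i - 1) ∧
          (L = 0 ↔ ∃ i, ‖α i‖ = 1 ∧ ζ i = 1)) ∧
      -- (2), when no cyclic resultant vanishes, so that `ν` exists
      ((∀ n : ℕ, cyclicResultant p n f ≠ 0) →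
        ∃ ν : ℤ, (p : ℝ) ^ (-ν) = ∏ i with ‖α i - 1‖ < 1, ‖padicLog p (α i)‖ ∧
          (∃ L : ℤ_[p],
            Tendsto (fun n : ℕ => (nonPPart p (cyclicResultant p n f) : ℤ_[p])) atTop (𝓝 L) ∧
            algebraMap ℚ_[p] ℂ_[p] L =
              limitSign p α * ξ * (∏ i with ‖α i‖ = 1 ∧ ‖α i - 1‖ = 1, (ζ i - 1)) *
                (p : ℂ_[p]) ^ (-ν) *
                ∏ i with ‖α i‖ = 1 ∧ ‖α i - 1‖ < 1, padicLog p (α i)) ∧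
          ((∀ i, ‖α i - 1‖ < 1 → ‖α i - 1‖ < (p : ℝ) ^ (-1 / ((p : ℝ) - 1))) →
            (p : ℝ) ^ ((μ : ℤ) + ν) = ‖((f.eval 1 : ℤ) : ℚ_[p])‖⁻¹)) ∧
      -- (2), degenerate case: the limit and the product of logarithms are both zero
      ((∃ n : ℕ, cyclicResultant p n f = 0) →
        Tendsto (fun n : ℕ => (nonPPart p (cyclicResultant p n f) : ℤ_[p])) atTop (𝓝 0) ∧
        ∏ i with ‖α i‖ = 1 ∧ ‖α i - 1‖ < 1, padicLog p (α i) = 0) := by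
  classical
  obtain ⟨g, hfg⟩ := hμ
  have hg : ¬ C (p : ℤ) ∣ g := by
    rintro ⟨h, rfl⟩
    exact hμ_max ⟨h, by rw [hfg, ← mul_assoc, ← C_mul, pow_succ]⟩
  have hfac : f.map (Int.castRingHom ℂ_[p]) = C (j a₀) * ∏ i, (X - C (α i)) := by
    have h := congrArg (Polynomial.map j) hfactor
    rw [Polynomial.map_map, Polynomial.map_mul, map_C, Polynomial.map_prod] at h
    rw [show Int.castRingHom ℂ_[p] = j.comp (algebraMap ℤ _) from RingHom.ext_int _ _, h]
    simp [hα]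
  have hdvd : C (p : ℤ) ∣ f ↔ μ ≠ 0 := by
    constructor
    · rintro h rfl
      exact hμ_max (by simpa using h)
    · intro h
      rw [hfg]
      exact Dvd.dvd.mul_right (_root_.map_dvd C (dvd_pow_self _ h)) g
  refine ⟨norm_normalizedLeadingTerm hfg hg hfac, ?_, fun i hi => ?_, fun ξ ζ hξ hζ =>
    ⟨fun h => ?_, fun h => ?_, fun hr => ?_, ?_⟩⟩
  · exact existsUnique_isClosestRootOfUnity_of_reduction_pow_eq
      (norm_normalizedLeadingTerm hfg hg hfac) one_ne_zero
      (by rw [pow_one]; exact reduction_normalizedLeadingTerm_pow hfg hg hfac)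
  · exact existsUnique_isClosestRootOfUnity_root hg (map_primitive_eq hfg hfac) hi
  · exact tendsto_cyclicResultant_zero_of_prime_dvd hfg hg hfac hξ hζ (hdvd.1 h)
  · exact exists_tendsto_cyclicResultant hfg hg hfac hξ hζ (not_not.1 (mt hdvd.2 h))
  · obtain ⟨ν, hν, hL⟩ := exists_tendsto_nonPPart hfg hg hfac hξ hζ hr
    exact ⟨ν, hν, hL, zpow_add_eq_inv_norm_eval_one hfg hg hfac hν⟩
  · rintro ⟨n, hn⟩
    exact tendsto_nonPPart_zero hfac hf hn
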